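/- Let $M_d$ denote the complex $d\times d$ matrices, $K_d\subset M_d$ the convex set of density matrices (positive semidefinite, trace one), $K_{mn}$ the density matrices in $M_m\otimes M_n$, and $S\subset K_{mn}$ the separable ones, i.e. those of the form $\sum_\gamma A_\gamma\otimes B_\gamma$ (finite sum) with all $A_\gamma\in M_m$, $B_\gamma\in M_n$ positive semidefinite. For a unit vector $x$ let $P_x$ be the orthogonal projection onto $\mathbb{C}x$. Matrices in $M_n$ are called independent if the sum of their images is direct. A face of a convex set $C$ is a convex subset $F\subseteq C$ such that, whenever $X,Y\in C$ and $tX+(1-t)Y\in F$ for some $0<t<1$, both $X$ and $Y$ lie in $F$; $\operatorname{face}_C X$ is the smallest face of $C$ containing $X\in C$. A set $Y$ is the direct convex sum of convex sets $F_1,\dots,F_q$, written $Y=\operatorname{co}\bigoplus_\nu F_\nu$, if $Y$ is the convex hull of $\bigcup_\nu F_\nu$ and each $y\in Y$ has a unique decomposition $y=\sum_\nu t_\nu y_\nu$ with $t_\nu\ge 0$, $\sum_\nu t_\nu=1$, $y_\nu\in F_\nu$ (uniqueness meaning that all $t_\nu$, and those $y_\nu$ with $t_\nu\neq 0$, are determined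 by $y$). **Theorem.** Let $T=\sum_{\gamma=1}^p A_\gamma\otimes B_\gamma$ be a density matrix in $M_m\otimes M_n$, where $A_1,\dots,A_p\in M_m$ are rank one density matrices and $B_1,\dots,B_p\in M_n$ are independent positive semidefinite matrices. Then there are $q\in\mathbb{N}$, unit vectors $x_1,\dots,x_q\in\mathbb{C}^m$ with $P_{x_1},\dots,P_{x_q}$ distinct, independent density matrices $C_1,\dots,C_q\in M_n$, and $\lambda_1,\dots,\lambda_q>0$ with $\sum_\nu\lambda_\nu=1$, such that $$T=\sum_{\nu=1}^q\lambda_\nu\,P_{x_\nu}\otimes C_\nu .$$ This decomposition is unique: any other decomposition of $T$ of this kind has the same number of terms and, after a permutation of the indices, the same $\lambda_\nu$, $P_{x_\nu}$ and $C_\nu$. For each $\nu$ the face $\operatorname{face}_S(P_{x_\nu}\otimes C_\nu)$ is also a face of $K_{mn}$, with $$\operatorname{face}_S(P_{x_\nu}\otimes C_\nu)=\operatorname{face}_{K_{mn}}(P_{x_\nu}\otimes C_\nu)=P_{x_\nu}\otimes\operatorname{face}_{K_n}C_\nu ,$$ where $P\otimes F=\{P\otimes D: D\in F\}$. Moreover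 $$\operatorname{face}_S T=\operatorname{co}\bigoplus_{\nu=1}^q\operatorname{face}_{K_{mn}}(P_{x_\nu}\otimes C_\nu)=\operatorname{co}\bigoplus_{\nu=1}^q\bigl(P_{x_\nu}\otimes\operatorname{face}_{K_n}C_\nu\bigr).$$ -/

import Mathlib

open scoped Kronecker ComplexOrder

/-- The state space `K` of the matrix algebra indexed by `ι`: the density matrices, i.e. the
positive semidefinite matrices of trace one. For `ι = Fin d` this is `K_d`; for
`ι = Fin m × Fin n` it is `K_{mn}`, where `M_m ⊗ M_n` is identified with the matrices indexed by
`Fin m × Fin n` through the Kronecker product. -/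
def stateSpace (ι : Type*) [Fintype ι] : Set (Matrix ι ι ℂ) :=
  {A | A.PosSemidef ∧ A.trace = 1}

/-- The separable state space `S` of `M_m ⊗ M_n`: the density matrices that admit a representation
`∑ A_γ ⊗ B_γ` with all `A_γ` and `B_γ` positive semidefinite. -/
def separableStates (m n : ℕ) : Set (Matrix (Fin m × Fin n) (Fin m × Fin n) ℂ) :=
  {T | T ∈ stateSpace (Fin m × Fin n) ∧
    ∃ (p : ℕ) (A : Fin p → Matrix (Fin m) (Fin m) ℂ) (B : Fin p → Matrix (Fin n) (Fin n) ℂ),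
      (∀ γ, (A γ).PosSemidef) ∧ (∀ γ, (B γ).PosSemidef) ∧ T = ∑ γ, A γ ⊗ₖ B γ}

/-- For a unit vector `x`, the matrix `x x*` of the orthogonal projection onto `ℂ x`. -/
def pureState {ι : Type*} (x : EuclideanSpace ℂ ι) : Matrix ι ι ℂ :=
  Matrix.vecMulVec x.ofLp (star x.ofLp)

/-- A family of matrices is independent if their images (column spaces) are independent
subspaces, i.e. the sum of the images is direct. -/
def IndependentImages {κ : Type*} {n : ℕ} (B : κ → Matrix (Fin n) (Fin n) ℂ) : Prop :=
  iSupIndep fun γ => LinearMap.range (B γ).mulVecLin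

/-- `F` is a face of the convex set `C`: a convex subset of `C` such that whenever a proper convex
combination of two points of `C` lies in `F`, both points lie in `F`. -/
def IsConvexFace {E : Type*} [AddCommGroup E] [Module ℝ E] (C F : Set E) : Prop :=
  Convex ℝ F ∧ IsExtreme ℝ C F

/-- The smallest face of the convex set `C` containing the point `A` of `C`. -/
def generatedFace {E : Type*} [AddCommGroup E] [Module ℝ E] (C : Set E) (A : E) : Set E :=
  ⋂₀ {F | IsConvexFace C F ∧ A ∈ F}

/-- `Y` is the direct convex sum of the convex sets `F i`: it is the convex hull of their union,
and each of its points has a unique convex decomposition `∑ w i • z i` with `z i ∈ F i`.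
As usual, uniqueness of `z i` is meant for the terms that occur with non-zero weight. -/
def IsDirectConvexSum {ι E : Type*} [Fintype ι] [AddCommGroup E] [Module ℝ E]
    (F : ι → Set E) (Y : Set E) : Prop :=
  Y = convexHull ℝ (⋃ i, F i) ∧
  ∀ y ∈ Y,
    (∃ w ∈ stdSimplex ℝ ι, ∃ z : ι → E, (∀ i, z i ∈ F i) ∧ y = ∑ i, w i • z i) ∧
    ∀ w ∈ stdSimplex ℝ ι, ∀ w' ∈ stdSimplex ℝ ι, ∀ z z' : ι → E,
      (∀ i, z i ∈ F i) → (∀ i, z' i ∈ F i) →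
      y = ∑ i, w i • z i → y = ∑ i, w' i • z' i →
      ∀ i, w i = w' i ∧ (w i ≠ 0 → z i = z' i)

/-- `T = ∑ w_ν P_{x_ν} ⊗ C_ν` is a convex decomposition (with positive weights) where the `x_ν` are
unit vectors with distinct projections `P_{x_ν}` and the `C_ν` are independent density matrices. -/
structure IsCanonicalDecomposition {m n q : ℕ}
    (T : Matrix (Fin m × Fin n) (Fin m × Fin n) ℂ) (w : Fin q → ℝ)
    (x : Fin q → EuclideanSpace ℂ (Fin m)) (C : Fin q → Matrix (Fin n) (Fin n) ℂ) : Prop where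
  weight_pos : ∀ ν, 0 < w ν
  weight_sum : ∑ ν, w ν = 1
  norm_eq_one : ∀ ν, ‖x ν‖ = 1
  distinct : Function.Injective fun ν => pureState (x ν)
  density : ∀ ν, C ν ∈ stateSpace (Fin n)
  independent : IndependentImages C
  eq_sum : T = ∑ ν, w ν • (pureState (x ν) ⊗ₖ C ν)

/-! The core is a statement about product vectors. If `a ⊗ b` lies in the range of `T = ∑ w_ν
P_{x_ν} ⊗ C_ν`, then each row `a_i b` equals `∑ x_ν(i) v_ν` with fixed `v_ν` in the image of `C_ν`.
Directness of these images forces `x_ν` to be parallel to `a` whenever `v_ν ≠ 0`. As the projections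
are distinct, only one `ν` survives, and `b` lies in the image of `C_ν`
(`exists_eq_smul_of_mul_eq_sum`).

A rank one positive matrix dominated by a multiple of `T` has its vector in the range of `T`
(`mem_range_mulVecLin_of_posSemidef_sub`). Hence a separable `A ≤ r T` has the form `∑ P_{x_ν} ⊗
E_ν` with the image of `E_ν` inside that of `C_ν`. Such coefficients `E_ν` are unique
(`eq_of_sum_pureState_kronecker_eq`). If `A` is in the face of `T`, then `A` and `r T - A` are both
separable for some `r`. Comparing coefficients bounds each `E_ν` by a multiple of `C_ν`, which
describes the face and makes the convex sum direct.

The same range argument applied to two decompositions of `T` matches their projections. Existence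
comes from merging the terms with equal `A_γ`. -/

section Faces

/-! ### Faces generated by a point of a convex set. -/

variable {E : Type*} [AddCommGroup E] [Module ℝ E]

/-- The points `A` whose segment to `T` can be prolonged beyond `T` inside `C` form a face
containing `T`, and every face containing `T` must contain them. The value `s = 0` covers `A = T`.
-/
theorem mem_generatedFace_iff {C : Set E} (hC : Convex ℝ C) {T : E} (hT : T ∈ C) {A : E} :
    A ∈ generatedFace C T ↔
      A ∈ C ∧ ∃ s : ℝ, 0 ≤ s ∧ ∃ B ∈ C, (1 + s) • T = A + s • B := by
  constructor
  · intro hA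
    have key : IsConvexFace C {A | A ∈ C ∧ ∃ s : ℝ, 0 ≤ s ∧ ∃ B ∈ C, (1 + s) • T = A + s • B} := by
      refine ⟨?_, ?_, ?_⟩
      · rintro A₁ ⟨h₁, s₁, hs₁, B₁, hB₁, e₁⟩ A₂ ⟨h₂, s₂, hs₂, B₂, hB₂, e₂⟩ a b ha hb hab
        refine ⟨hC h₁ h₂ ha hb hab, a * s₁ + b * s₂, by positivity, ?_⟩
        have e : (1 + (a * s₁ + b * s₂)) • T
            = (a • A₁ + b • A₂) + ((a * s₁) • B₁ + (b * s₂) • B₂) := by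
          have : 1 + (a * s₁ + b * s₂) = a * (1 + s₁) + b * (1 + s₂) := by
            linear_combination -hab
          rw [this, add_smul, mul_smul, mul_smul, e₁, e₂]
          module
        rcases (by positivity : 0 ≤ a * s₁ + b * s₂).eq_or_lt with h0 | h0
        · have h1 : a * s₁ = 0 := by
            have := mul_nonneg ha hs₁; have := mul_nonneg hb hs₂; linarith
          have h2 : b * s₂ = 0 := by
            have := mul_nonneg ha hs₁; have := mul_nonneg hb hs₂; linarith
          -- With total weight zero the point `B` is irrelevant; `T` is only a default.
          refine ⟨T, hT, ?_⟩
          rw [e, h1, h2]; simp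
        · refine ⟨(a * s₁ / (a * s₁ + b * s₂)) • B₁ + (b * s₂ / (a * s₁ + b * s₂)) • B₂,
            hC hB₁ hB₂ (by positivity) (by positivity) (by field_simp), ?_⟩
          rw [e, smul_add, smul_smul, smul_smul, mul_div_cancel₀ _ h0.ne',
            mul_div_cancel₀ _ h0.ne']
      · exact fun A hA => hA.1
      · rintro X hX Y hY _ ⟨-, s, hs, B, hB, e⟩ ⟨a, b, ha, hb, hab, rfl⟩
        -- Divide `(1 + s) T = a X + b Y + s B` by `a` and merge `Y` and `B` into one point.
        refine ⟨hX, (b + s) / a, by positivity,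
          (b / (b + s)) • Y + (s / (b + s)) • B,
          hC hY hB (by positivity) (by positivity) (by field_simp), ?_⟩
        have h1 : 1 + (b + s) / a = a⁻¹ * (1 + s) := by
          field_simp; linarith
        have hbs : 0 < b + s := by positivity
        rw [h1, mul_smul, e, smul_add, smul_add, smul_add, smul_smul, smul_smul, smul_smul,
          smul_smul, smul_smul, inv_mul_cancel₀ ha.ne', one_smul, add_assoc]
        congr 3 <;> field_simp
    exact hA _ ⟨key, hT, 0, le_rfl, T, hT, by simp⟩
  · rintro ⟨hA, s, hs, B, hB, e⟩ F ⟨hF, hTF⟩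
    rcases hs.eq_or_lt with rfl | hs
    · obtain rfl : T = A := by simpa using e
      exact hTF
    · refine hF.2.2 hA hB hTF ⟨(1 + s)⁻¹, (1 + s)⁻¹ * s, by positivity, by positivity,
        by field_simp, ?_⟩
      rw [mul_smul, ← smul_add, ← e, inv_smul_smul₀ (by positivity)]

theorem isConvexFace_generatedFace {C : Set E} (hC : Convex ℝ C) {T : E} (hT : T ∈ C) :
    IsConvexFace C (generatedFace C T) := by
  refine ⟨convex_sInter fun F hF => hF.1.1, fun A hA => ((mem_generatedFace_iff hC hT).1 hA).1, ?_⟩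
  intro X hX Y hY Z hZ h F hF
  exact hF.1.2.2 hX hY (hZ F hF) h

theorem self_mem_generatedFace (C : Set E) (T : E) : T ∈ generatedFace C T := fun _ hF => hF.2

theorem generatedFace_subset {C F : Set E} {T : E} (hF : IsConvexFace C F) (hT : T ∈ F) :
    generatedFace C T ⊆ F := fun _ hA => hA F ⟨hF, hT⟩

theorem generatedFace_subset_of_subset {C D : Set E} (hC : Convex ℝ C) (hD : Convex ℝ D)
    (hCD : C ⊆ D) {T : E} (hT : T ∈ C) : generatedFace C T ⊆ generatedFace D T := by
  intro A hA
  obtain ⟨hA, s, hs, B, hB, e⟩ := (mem_generatedFace_iff hC hT).1 hA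
  exact (mem_generatedFace_iff hD (hCD hT)).2 ⟨hCD hA, s, hs, B, hCD hB, e⟩

/-- All terms but the `i`-th are merged into a single point of `C`, which reduces the claim to two
points. -/
theorem IsConvexFace.mem_of_sum_mem {ι : Type*} [Fintype ι] {C F : Set E} (hC : Convex ℝ C)
    (hF : IsConvexFace C F) {w : ι → ℝ} {z : ι → E} (hw : ∀ i, 0 ≤ w i) (hw1 : ∑ i, w i = 1)
    (hz : ∀ i, z i ∈ C) (h : ∑ i, w i • z i ∈ F) {i : ι} (hi : 0 < w i) : z i ∈ F := by
  classical
  rw [← Finset.add_sum_erase _ _ (Finset.mem_univ i)] at h hw1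
  have h0 : 0 ≤ ∑ j ∈ Finset.univ.erase i, w j := Finset.sum_nonneg fun j _ => hw j
  rcases h0.eq_or_lt with h0 | h0
  · have hzero := (Finset.sum_eq_zero_iff_of_nonneg (fun j _ => hw j)).1 h0.symm
    rw [← h0, add_zero] at hw1
    rw [Finset.sum_eq_zero fun j hj => by rw [hzero j hj, zero_smul], hw1, one_smul, add_zero] at h
    exact h
  · refine hF.2.2 (hz i) (hC.sum_mem (t := Finset.univ.erase i)
      (w := fun j => w j / ∑ j ∈ Finset.univ.erase i, w j) (fun j _ => div_nonneg (hw j) h0.le)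
      (by rw [← Finset.sum_div, div_self h0.ne']) (fun j _ => hz j)) h
      ⟨w i, ∑ j ∈ Finset.univ.erase i, w j, hi, h0, hw1, ?_⟩
    rw [Finset.smul_sum]
    congr 1
    refine Finset.sum_congr rfl fun j _ => ?_
    rw [smul_smul, mul_div_cancel₀ _ h0.ne']

end Faces

/-! ### Positive semidefinite matrices: ranges, domination and pure states. -/

section PosSemidef

open Matrix

variable {ι κ : Type*}

theorem vecMulVec_kronecker_vecMulVec (a : ι → ℂ) (b : κ → ℂ) :
    vecMulVec a (star a) ⊗ₖ vecMulVec b (star b) =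
      vecMulVec (fun p : ι × κ => a p.1 * b p.2) (star fun p : ι × κ => a p.1 * b p.2) := by
  ext ⟨i, k⟩ ⟨j, l⟩
  simp [vecMulVec_apply]
  ring

theorem sum_kronecker {α : Type*} (s : Finset α) (A : α → Matrix ι ι ℂ) (B : Matrix κ κ ℂ) :
    (∑ a ∈ s, A a) ⊗ₖ B = ∑ a ∈ s, A a ⊗ₖ B := by
  ext ⟨i, k⟩ ⟨j, l⟩
  simp [Matrix.sum_apply, Finset.sum_mul]

theorem kronecker_sum {α : Type*} (s : Finset α) (A : Matrix ι ι ℂ) (B : α → Matrix κ κ ℂ) :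
    A ⊗ₖ (∑ a ∈ s, B a) = ∑ a ∈ s, A ⊗ₖ B a := by
  ext ⟨i, k⟩ ⟨j, l⟩
  simp [Matrix.sum_apply, Finset.mul_sum]

theorem pureState_smul (c : ℂ) (x : EuclideanSpace ℂ ι) :
    pureState (c • x) = (‖c‖ ^ 2) • pureState x := by
  ext i j
  simp only [pureState, vecMulVec_apply, Matrix.smul_apply, PiLp.smul_apply, Pi.star_apply,
    smul_eq_mul, star_mul', Complex.real_smul]
  have : (((‖c‖ ^ 2 : ℝ)) : ℂ) = c * star c := by
    rw [Complex.star_def, Complex.mul_conj, Complex.normSq_eq_norm_sq]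
  rw [this]; ring

theorem posSemidef_sub_of_posSemidef_sub_sum {α : Type*} {s : Finset α} {T : Matrix ι ι ℂ}
    {X : α → Matrix ι ι ℂ} (hX : ∀ a ∈ s, (X a).PosSemidef) (h : (T - ∑ a ∈ s, X a).PosSemidef)
    {a : α} (ha : a ∈ s) : (T - X a).PosSemidef := by
  classical
  have := h.add (posSemidef_sum (s.erase a) fun b hb => hX b (Finset.mem_of_mem_erase hb))
  rw [← Finset.add_sum_erase _ _ ha] at this
  simpa [sub_add_eq_sub_sub] using this

variable [Fintype ι]

theorem Matrix.PosSemidef.exists_sum_vecMulVec {A : Matrix ι ι ℂ} (hA : A.PosSemidef) :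
    ∃ u : ι → ι → ℂ, A = ∑ k, vecMulVec (u k) (star (u k)) := by
  classical
  obtain ⟨M, rfl⟩ : ∃ M : Matrix ι ι ℂ, A = Mᴴ * M := by
    open scoped MatrixOrder in
    obtain ⟨M, hM⟩ := CStarAlgebra.nonneg_iff_eq_star_mul_self.1 hA.nonneg
    exact ⟨M, hM⟩
  refine ⟨fun k => star (M k), ?_⟩
  ext i j
  simp [Matrix.mul_apply, Matrix.sum_apply, vecMulVec_apply]

/-- If `T v = 0`, positivity gives `-|u* v|² ≥ 0`. So `u` is orthogonal to the kernel of the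
Hermitian matrix `T`, that is, it lies in the range. -/
theorem mem_range_mulVecLin_of_posSemidef_sub {T : Matrix ι ι ℂ} {u : ι → ℂ}
    (h : (T - vecMulVec u (star u)).PosSemidef) : u ∈ LinearMap.range T.mulVecLin := by
  classical
  have hT : T.IsHermitian := by
    have := h.1.add (posSemidef_vecMulVec_self_star u).1
    simpa using this
  have hsymm : (toEuclideanLin T).IsSymmetric := isSymmetric_toEuclideanLin_iff.2 hT
  have hmem : WithLp.toLp 2 u ∈ LinearMap.range (toEuclideanLin T) := by
    rw [← Submodule.orthogonal_orthogonal (LinearMap.range (toEuclideanLin T)),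
      hsymm.orthogonal_range, Submodule.mem_orthogonal']
    intro v hv
    have hv' : T *ᵥ v.ofLp = 0 := by
      have := congrArg WithLp.ofLp (LinearMap.mem_ker.1 hv)
      simpa using this
    have h2 := h.dotProduct_mulVec_nonneg v.ofLp
    rw [sub_mulVec, hv', zero_sub, vecMulVec_mulVec, dotProduct_neg] at h2
    have e : star v.ofLp ⬝ᵥ (MulOpposite.op (star u ⬝ᵥ v.ofLp) • u) =
        star (star u ⬝ᵥ v.ofLp) * (star u ⬝ᵥ v.ofLp) := by
      rw [dotProduct_smul, MulOpposite.smul_eq_mul_unop, MulOpposite.unop_op]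
      congr 1
      rw [← star_dotProduct_star, star_star, dotProduct_comm]
    rw [e] at h2
    have h5 : star (star u ⬝ᵥ v.ofLp) * (star u ⬝ᵥ v.ofLp) = 0 :=
      le_antisymm (by simpa using h2) (star_mul_self_nonneg _)
    rw [EuclideanSpace.inner_eq_star_dotProduct, dotProduct_comm]
    simpa using h5
  obtain ⟨v, hv⟩ := hmem
  refine ⟨v.ofLp, ?_⟩
  have := congrArg WithLp.ofLp hv
  simpa using this

theorem Matrix.PosSemidef.range_le_of_posSemidef_sub {A T : Matrix ι ι ℂ} (hA : A.PosSemidef)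
    (h : (T - A).PosSemidef) : LinearMap.range A.mulVecLin ≤ LinearMap.range T.mulVecLin := by
  obtain ⟨u, rfl⟩ := hA.exists_sum_vecMulVec
  rintro _ ⟨v, rfl⟩
  rw [mulVecLin_apply, sum_mulVec]
  refine Submodule.sum_mem _ fun k hk => ?_
  rw [vecMulVec_mulVec, op_smul_eq_smul]
  exact Submodule.smul_mem _ _ (mem_range_mulVecLin_of_posSemidef_sub
    (posSemidef_sub_of_posSemidef_sub_sum (fun _ _ => posSemidef_vecMulVec_self_star _) h hk))

theorem convex_stateSpace : Convex ℝ (stateSpace ι) := by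
  rintro A ⟨hA, hA1⟩ B ⟨hB, hB1⟩ a b ha hb hab
  refine ⟨(hA.smul ha).add (hB.smul hb), ?_⟩
  rw [trace_add, trace_smul, trace_smul, hA1, hB1, ← add_smul, hab, one_smul]

theorem Matrix.PosSemidef.exists_smul_stateSpace {A : Matrix ι ι ℂ} (hA : A.PosSemidef)
    (h : A ≠ 0) : ∃ r : ℝ, 0 < r ∧ ∃ D ∈ stateSpace ι, A = r • D := by
  have h0 := hA.trace_nonneg
  have hne : A.trace ≠ 0 := fun h' => h (hA.trace_eq_zero_iff.1 h')
  obtain ⟨hre, him⟩ := Complex.nonneg_iff.1 h0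
  have hr : A.trace = (A.trace.re : ℂ) := Complex.ext (by simp) (by simp [← him])
  have hpos : 0 < A.trace.re := lt_of_le_of_ne hre fun h' => hne (by rw [hr, ← h']; simp)
  refine ⟨A.trace.re, hpos, A.trace.re⁻¹ • A, ⟨hA.smul (by positivity), ?_⟩, ?_⟩
  · rw [trace_smul]
    nth_rewrite 2 [hr]
    simp [hpos.ne']
  · rw [smul_inv_smul₀ hpos.ne']

theorem pureState_posSemidef (x : EuclideanSpace ℂ ι) : (pureState x).PosSemidef :=
  posSemidef_vecMulVec_self_star _

theorem trace_pureState {x : EuclideanSpace ℂ ι} (hx : ‖x‖ = 1) : (pureState x).trace = 1 := by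
  rw [pureState, trace_vecMulVec, ← EuclideanSpace.inner_eq_star_dotProduct,
    inner_self_eq_norm_sq_to_K, hx]
  simp

theorem pureState_mem_stateSpace {x : EuclideanSpace ℂ ι} (hx : ‖x‖ = 1) :
    pureState x ∈ stateSpace ι := ⟨pureState_posSemidef x, trace_pureState hx⟩

theorem norm_eq_one_of_trace_pureState {x : EuclideanSpace ℂ ι} (hx : (pureState x).trace = 1) :
    ‖x‖ = 1 := by
  rw [pureState, trace_vecMulVec, ← EuclideanSpace.inner_eq_star_dotProduct,
    inner_self_eq_norm_sq_to_K] at hx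
  have : ‖x‖ ^ 2 = 1 := Complex.ofReal_injective (by simpa using hx)
  exact (pow_eq_one_iff_of_nonneg (norm_nonneg x) two_ne_zero).1 this

/-- In a sum `∑ u_k u_k*` equal to `A`, every `u_k` is in the range of `A`, so all are multiples
`c_k v` of one vector. The sum is then `(∑ |c_k|²) v v*`. -/
theorem exists_pureState_of_rank_eq_one {A : Matrix ι ι ℂ} (hA : A ∈ stateSpace ι)
    (hr : A.rank = 1) : ∃ x : EuclideanSpace ℂ ι, ‖x‖ = 1 ∧ A = pureState x := by
  classical
  obtain ⟨u, hu⟩ := hA.1.exists_sum_vecMulVec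
  rw [Matrix.rank, finrank_eq_one_iff'] at hr
  obtain ⟨⟨v, hv⟩, -, hspan⟩ := hr
  have hmem : ∀ k, ∃ c : ℂ, u k = c • v := by
    intro k
    have hk : u k ∈ LinearMap.range A.mulVecLin :=
      mem_range_mulVecLin_of_posSemidef_sub (posSemidef_sub_of_posSemidef_sub_sum
        (X := fun k => vecMulVec (u k) (star (u k)))
        (fun _ _ => posSemidef_vecMulVec_self_star _)
        (by rw [← hu, sub_self]; exact .zero) (Finset.mem_univ k))
    obtain ⟨c, hc⟩ := hspan ⟨u k, hk⟩
    exact ⟨c, (congrArg Subtype.val hc).symm⟩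
  choose c hc using hmem
  have hAv : A = (∑ k, ‖c k‖ ^ 2) • pureState (WithLp.toLp 2 v) := by
    rw [Finset.sum_smul]
    refine hu.trans (Finset.sum_congr rfl fun k _ => ?_)
    rw [← pureState_smul, hc k]
    rfl
  have h0 : 0 ≤ ∑ k, ‖c k‖ ^ 2 := Finset.sum_nonneg fun k _ => by positivity
  have key : A = pureState (((√(∑ k, ‖c k‖ ^ 2) : ℝ) : ℂ) • WithLp.toLp 2 v) := by
    rw [pureState_smul, Complex.norm_real, Real.norm_of_nonneg (Real.sqrt_nonneg _),
      Real.sq_sqrt h0, hAv]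
  exact ⟨_, norm_eq_one_of_trace_pureState (by rw [← key]; exact hA.2), key⟩

/-- For the trace one slice of a cone, prolonging the segment beyond `T` amounts to domination by a
multiple of `T` in the order of the cone; traces give `r = 1 + s`. It serves both `stateSpace` and
`separableStates`. -/
theorem mem_generatedFace_iff_exists_smul_sub_mem {S K : Set (Matrix ι ι ℂ)} (hS : Convex ℝ S)
    (hSK : ∀ A, A ∈ S ↔ A ∈ K ∧ A.trace = 1) (hK : ∀ A ∈ K, A.PosSemidef)
    (hsmul : ∀ A ∈ K, ∀ r : ℝ, 0 ≤ r → r • A ∈ K) {T A : Matrix ι ι ℂ} (hT : T ∈ S) :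
    A ∈ generatedFace S T ↔ A ∈ S ∧ ∃ r : ℝ, r • T - A ∈ K := by
  rw [mem_generatedFace_iff hS hT]
  refine and_congr_right fun hA => ⟨?_, ?_⟩
  · rintro ⟨s, hs, B, hB, e⟩
    exact ⟨1 + s, by rw [e, add_sub_cancel_left]; exact hsmul _ ((hSK _).1 hB).1 _ hs⟩
  · rintro ⟨r, hr⟩
    have htr : (r • T - A).trace = ((r - 1 : ℝ) : ℂ) := by
      rw [trace_sub, trace_smul, ((hSK _).1 hA).2, ((hSK _).1 hT).2]
      simp
    have h0 : 0 ≤ r - 1 := by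
      have := (hK _ hr).trace_nonneg
      rw [htr] at this
      exact_mod_cast this
    refine ⟨r - 1, h0, ?_⟩
    rcases h0.eq_or_lt with h0 | h0
    · have : r • T - A = 0 := (hK _ hr).trace_eq_zero_iff.1 (by rw [htr, ← h0]; simp)
      refine ⟨T, hT, ?_⟩
      rw [show r = 1 by linarith, one_smul] at this
      rw [← h0, zero_smul, add_zero, add_zero, one_smul, sub_eq_zero.1 this]
    · refine ⟨(r - 1)⁻¹ • (r • T - A), (hSK _).2 ⟨hsmul _ hr _ (by positivity), ?_⟩, ?_⟩
      · rw [trace_smul, htr, Complex.real_smul, ← Complex.ofReal_mul, inv_mul_cancel₀ h0.ne',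
          Complex.ofReal_one]
      · rw [smul_inv_smul₀ h0.ne', add_sub_cancel, add_sub_cancel]

theorem mem_generatedFace_stateSpace {T A : Matrix ι ι ℂ} (hT : T ∈ stateSpace ι) :
    A ∈ generatedFace (stateSpace ι) T ↔ A ∈ stateSpace ι ∧ ∃ r : ℝ, (r • T - A).PosSemidef :=
  mem_generatedFace_iff_exists_smul_sub_mem (K := {A | A.PosSemidef}) convex_stateSpace
    (fun _ => Iff.rfl) (fun _ h => h) (fun _ h _ hr => h.smul hr) hT

theorem range_smul_mulVecLin_le (r : ℝ) (T : Matrix ι ι ℂ) :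
    LinearMap.range (r • T).mulVecLin ≤ LinearMap.range T.mulVecLin := by
  rintro _ ⟨v, rfl⟩
  refine ⟨r • v, ?_⟩
  simp

theorem range_le_of_mem_generatedFace {T A : Matrix ι ι ℂ} (hT : T ∈ stateSpace ι)
    (hA : A ∈ generatedFace (stateSpace ι) T) :
    LinearMap.range A.mulVecLin ≤ LinearMap.range T.mulVecLin := by
  obtain ⟨hA, r, hr⟩ := (mem_generatedFace_stateSpace hT).1 hA
  exact (hA.1.range_le_of_posSemidef_sub hr).trans (range_smul_mulVecLin_le r T)

/-- Partial trace over the first factor: the diagonal blocks are `P i i • X`. -/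
theorem eq_sum_submatrix_kronecker {P : Matrix ι ι ℂ} (hP : P.trace = 1) (X : Matrix κ κ ℂ) :
    X = ∑ i, (P ⊗ₖ X).submatrix (fun k => (i, k)) (fun k => (i, k)) := by
  ext k l
  simp only [Matrix.sum_apply, submatrix_apply, kroneckerMap_apply, ← Finset.sum_mul]
  rw [show ∑ i, P i i = 1 from hP, one_mul]

theorem posSemidef_of_kronecker {P : Matrix ι ι ℂ} (hP : P.trace = 1) {X : Matrix κ κ ℂ}
    (h : (P ⊗ₖ X).PosSemidef) : X.PosSemidef := by
  rw [eq_sum_submatrix_kronecker hP X]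
  exact posSemidef_sum _ fun i _ => h.submatrix _

theorem pureState_kronecker_mulVec [Fintype κ] (x : EuclideanSpace ℂ ι) (C : Matrix κ κ ℂ)
    (f : ι × κ → ℂ) : (pureState x ⊗ₖ C) *ᵥ f =
      fun p => x p.1 * (C *ᵥ fun l => ∑ j, star (x j) * f (j, l)) p.2 := by
  ext ⟨i, k⟩
  simp only [mulVec, dotProduct, Fintype.sum_prod_type, kroneckerMap_apply, pureState,
    vecMulVec_apply, Finset.mul_sum, Pi.star_apply]
  rw [Finset.sum_comm]
  exact Finset.sum_congr rfl fun l _ => Finset.sum_congr rfl fun j _ => by ring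

/-- The vectors of a rank one splitting of `A` lie in the range of `P_x ⊗ C`, so each is a product
`x ⊗ z`. -/
theorem exists_eq_pureState_kronecker [Fintype κ] {x : EuclideanSpace ℂ ι} {C : Matrix κ κ ℂ}
    {A : Matrix (ι × κ) (ι × κ) ℂ} (hA : A.PosSemidef) {r : ℝ}
    (h : (r • (pureState x ⊗ₖ C) - A).PosSemidef) :
    ∃ D : Matrix κ κ ℂ, D.PosSemidef ∧ A = pureState x ⊗ₖ D := by
  obtain ⟨u, rfl⟩ := hA.exists_sum_vecMulVec
  have hu : ∀ p, ∃ z : κ → ℂ, u p = fun p => x p.1 * z p.2 := by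
    intro p
    obtain ⟨f, hf⟩ := range_smul_mulVecLin_le r _ (mem_range_mulVecLin_of_posSemidef_sub
      (posSemidef_sub_of_posSemidef_sub_sum (X := fun k => vecMulVec (u k) (star (u k)))
        (fun _ _ => posSemidef_vecMulVec_self_star _) h (Finset.mem_univ p)))
    exact ⟨_, by rw [← hf, mulVecLin_apply, pureState_kronecker_mulVec]⟩
  choose z hz using hu
  refine ⟨∑ p, vecMulVec (z p) (star (z p)),
    posSemidef_sum _ fun p _ => posSemidef_vecMulVec_self_star _, ?_⟩
  rw [kronecker_sum]
  refine Finset.sum_congr rfl fun p _ => ?_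
  rw [pureState, vecMulVec_kronecker_vecMulVec, hz p]

end PosSemidef

/-! ### The separable cone and the faces of product states. -/

section Separable

variable {m n : ℕ}

/-- The cone of the sums `∑ A_γ ⊗ B_γ` with positive semidefinite `A_γ` and `B_γ`. -/
def separableCone (m n : ℕ) : Set (Matrix (Fin m × Fin n) (Fin m × Fin n) ℂ) :=
  {T | ∃ (p : ℕ) (A : Fin p → Matrix (Fin m) (Fin m) ℂ) (B : Fin p → Matrix (Fin n) (Fin n) ℂ),
      (∀ γ, (A γ).PosSemidef) ∧ (∀ γ, (B γ).PosSemidef) ∧ T = ∑ γ, A γ ⊗ₖ B γ}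

theorem sum_kronecker_mem_separableCone {κ : Type*} [Fintype κ]
    {A : κ → Matrix (Fin m) (Fin m) ℂ} {B : κ → Matrix (Fin n) (Fin n) ℂ}
    (hA : ∀ γ, (A γ).PosSemidef) (hB : ∀ γ, (B γ).PosSemidef) :
    ∑ γ, A γ ⊗ₖ B γ ∈ separableCone m n := by
  let e := (Fintype.equivFin κ).symm
  exact ⟨_, A ∘ e, B ∘ e, fun _ => hA _, fun _ => hB _,
    (e.sum_comp fun γ => A γ ⊗ₖ B γ).symm⟩

theorem kronecker_mem_separableCone {A : Matrix (Fin m) (Fin m) ℂ} {B : Matrix (Fin n) (Fin n) ℂ}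
    (hA : A.PosSemidef) (hB : B.PosSemidef) : A ⊗ₖ B ∈ separableCone m n := by
  simpa using sum_kronecker_mem_separableCone (κ := Unit) (fun _ => hA) (fun _ => hB)

theorem add_mem_separableCone {X Y : Matrix (Fin m × Fin n) (Fin m × Fin n) ℂ}
    (hX : X ∈ separableCone m n) (hY : Y ∈ separableCone m n) : X + Y ∈ separableCone m n := by
  obtain ⟨p, A, B, hA, hB, rfl⟩ := hX
  obtain ⟨p', A', B', hA', hB', rfl⟩ := hY
  have := sum_kronecker_mem_separableCone (A := Sum.elim A A') (B := Sum.elim B B')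
    (by rintro (γ | γ); exacts [hA γ, hA' γ]) (by rintro (γ | γ); exacts [hB γ, hB' γ])
  simpa using this

theorem smul_mem_separableCone {X : Matrix (Fin m × Fin n) (Fin m × Fin n) ℂ}
    (hX : X ∈ separableCone m n) {r : ℝ} (hr : 0 ≤ r) : r • X ∈ separableCone m n := by
  obtain ⟨p, A, B, hA, hB, rfl⟩ := hX
  refine ⟨p, fun γ => r • A γ, B, fun γ => (hA γ).smul hr, hB, ?_⟩
  simp [Finset.smul_sum, Matrix.smul_kronecker]

theorem convex_separableStates : Convex ℝ (separableStates m n) := by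
  intro X hX Y hY a b ha hb hab
  exact ⟨convex_stateSpace hX.1 hY.1 ha hb hab,
    add_mem_separableCone (smul_mem_separableCone hX.2 ha) (smul_mem_separableCone hY.2 hb)⟩

theorem kronecker_mem_stateSpace {A : Matrix (Fin m) (Fin m) ℂ} {B : Matrix (Fin n) (Fin n) ℂ}
    (hA : A ∈ stateSpace (Fin m)) (hB : B ∈ stateSpace (Fin n)) :
    A ⊗ₖ B ∈ stateSpace (Fin m × Fin n) :=
  ⟨hA.1.kronecker hB.1, by rw [Matrix.trace_kronecker, hA.2, hB.2, mul_one]⟩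

theorem kronecker_mem_separableStates {A : Matrix (Fin m) (Fin m) ℂ}
    {B : Matrix (Fin n) (Fin n) ℂ} (hA : A ∈ stateSpace (Fin m)) (hB : B ∈ stateSpace (Fin n)) :
    A ⊗ₖ B ∈ separableStates m n :=
  ⟨kronecker_mem_stateSpace hA hB, kronecker_mem_separableCone hA.1 hB.1⟩

theorem posSemidef_of_mem_separableCone {X : Matrix (Fin m × Fin n) (Fin m × Fin n) ℂ}
    (hX : X ∈ separableCone m n) : X.PosSemidef := by
  obtain ⟨p, A, B, hA, hB, rfl⟩ := hX
  exact Matrix.posSemidef_sum _ fun γ _ => (hA γ).kronecker (hB γ)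

theorem mem_generatedFace_separableStates {T A : Matrix (Fin m × Fin n) (Fin m × Fin n) ℂ}
    (hT : T ∈ separableStates m n) : A ∈ generatedFace (separableStates m n) T ↔
      A ∈ separableStates m n ∧ ∃ r : ℝ, r • T - A ∈ separableCone m n :=
  mem_generatedFace_iff_exists_smul_sub_mem convex_separableStates
    (fun _ => ⟨fun h => ⟨h.2, h.1.2⟩, fun h => ⟨⟨posSemidef_of_mem_separableCone h.1, h.2⟩, h.1⟩⟩)
    (fun _ => posSemidef_of_mem_separableCone) (fun _ h _ hr => smul_mem_separableCone h hr) hT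

theorem smul_kronecker_sub_kronecker (P : Matrix (Fin m) (Fin m) ℂ)
    (C D : Matrix (Fin n) (Fin n) ℂ) (r : ℝ) :
    r • (P ⊗ₖ C) - P ⊗ₖ D = P ⊗ₖ (r • C - D) := by
  ext ⟨i, k⟩ ⟨j, l⟩
  simp; ring

theorem generatedFace_pureState_kronecker {x : EuclideanSpace ℂ (Fin m)} (hx : ‖x‖ = 1)
    {C : Matrix (Fin n) (Fin n) ℂ} (hC : C ∈ stateSpace (Fin n)) :
    generatedFace (stateSpace (Fin m × Fin n)) (pureState x ⊗ₖ C) =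
      (fun D => pureState x ⊗ₖ D) '' generatedFace (stateSpace (Fin n)) C := by
  have hP := pureState_mem_stateSpace hx
  ext A
  rw [mem_generatedFace_stateSpace (kronecker_mem_stateSpace hP hC)]
  constructor
  · rintro ⟨hA, r, hr⟩
    obtain ⟨D, hD, rfl⟩ := exists_eq_pureState_kronecker hA.1 hr
    rw [smul_kronecker_sub_kronecker] at hr
    refine ⟨D, (mem_generatedFace_stateSpace hC).2 ⟨⟨hD, ?_⟩, r,
      posSemidef_of_kronecker hP.2 hr⟩, rfl⟩
    have := hA.2
    rwa [Matrix.trace_kronecker, hP.2, one_mul] at this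
  · rintro ⟨D, hD, rfl⟩
    obtain ⟨hD, r, hr⟩ := (mem_generatedFace_stateSpace hC).1 hD
    refine ⟨kronecker_mem_stateSpace hP hD, r, ?_⟩
    rw [smul_kronecker_sub_kronecker]
    exact hP.1.kronecker hr

/-- Domination in `K_{mn}` is witnessed by the difference `P_x ⊗ (r C - D)`, a product of positive
matrices and hence already separable. -/
theorem generatedFace_separableStates_pureState_kronecker {x : EuclideanSpace ℂ (Fin m)}
    (hx : ‖x‖ = 1) {C : Matrix (Fin n) (Fin n) ℂ} (hC : C ∈ stateSpace (Fin n)) :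
    generatedFace (separableStates m n) (pureState x ⊗ₖ C) =
      generatedFace (stateSpace (Fin m × Fin n)) (pureState x ⊗ₖ C) := by
  have hP := pureState_mem_stateSpace hx
  refine (generatedFace_subset_of_subset convex_separableStates convex_stateSpace
    (fun _ h => h.1) (kronecker_mem_separableStates hP hC)).antisymm ?_
  rw [generatedFace_pureState_kronecker hx hC]
  rintro _ ⟨D, hD, rfl⟩
  obtain ⟨hD, r, hr⟩ := (mem_generatedFace_stateSpace hC).1 hD
  refine (mem_generatedFace_separableStates (kronecker_mem_separableStates hP hC)).2
    ⟨kronecker_mem_separableStates hP hD, r, ?_⟩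
  rw [smul_kronecker_sub_kronecker]
  exact kronecker_mem_separableCone hP.1 hr

end Separable

open Matrix

/-! ### Independent images and uniqueness of coefficients. -/

section Independent

variable {n : ℕ} {κ : Type*} [Fintype κ]

theorem iSupIndep.eq_zero_of_sum_eq_zero {V : κ → Submodule ℂ (Fin n → ℂ)} (hV : iSupIndep V)
    {v : κ → Fin n → ℂ} (hv : ∀ ν, v ν ∈ V ν) (h : ∑ ν, v ν = 0) (ν : κ) : v ν = 0 :=
  (iSupIndep_iff_finsetSum_eq_zero_imp_eq_zero V).1 hV Finset.univ v (fun ν _ => hv ν) h ν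
    (Finset.mem_univ ν)

theorem independentImages_iff {B : κ → Matrix (Fin n) (Fin n) ℂ} :
    IndependentImages B ↔
      ∀ u : κ → Fin n → ℂ, ∑ ν, B ν *ᵥ u ν = 0 → ∀ ν, B ν *ᵥ u ν = 0 := by
  classical
  constructor
  · exact fun h u hu => iSupIndep.eq_zero_of_sum_eq_zero h (v := fun ν => B ν *ᵥ u ν)
      (fun ν => ⟨u ν, rfl⟩) hu
  · intro h
    refine (iSupIndep_iff_finsetSum_eq_zero_imp_eq_zero _).2 fun s v hv hs ν hν => ?_
    choose! u hu using hv
    have h0 := h (fun ν => if ν ∈ s then u ν else 0) (by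
      refine (Finset.sum_subset s.subset_univ fun ν _ hν => ?_).symm.trans
        ((Finset.sum_congr rfl fun ν hν => ?_).trans hs)
      · rw [if_neg hν, mulVec_zero]
      · rw [if_pos hν]
        exact hu ν hν) ν
    rw [if_pos hν] at h0
    exact (hu ν hν).symm.trans h0

theorem IndependentImages.sum_fiber {l : Type*} [Fintype l] [DecidableEq l]
    {B : κ → Matrix (Fin n) (Fin n) ℂ} (hB : IndependentImages B) (g : κ → l) :
    IndependentImages fun ν => ∑ γ with g γ = ν, B γ := by
  refine independentImages_iff.2 fun u hu ν => ?_
  have e : ∀ ν, (∑ γ with g γ = ν, B γ) *ᵥ u ν = ∑ γ with g γ = ν, B γ *ᵥ u (g γ) := by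
    intro ν
    rw [sum_mulVec]
    exact Finset.sum_congr rfl fun γ hγ => by rw [(Finset.mem_filter.1 hγ).2]
  simp only [e, Finset.sum_fiberwise] at hu
  rw [e]
  exact Finset.sum_eq_zero fun γ _ => independentImages_iff.1 hB (fun γ => u (g γ)) hu γ

variable {m : ℕ}

/-- The decisive use of independence. The hypothesis `hxy` says that at most one `x ν` is parallel
to `y`. -/
theorem exists_eq_smul_of_mul_eq_sum {x : κ → EuclideanSpace ℂ (Fin m)}
    (hx : ∀ ν, x ν ≠ 0) {y : EuclideanSpace ℂ (Fin m)} (hy : y ≠ 0)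
    (hxy : ∀ ν ν' (c d : ℂ), x ν = c • y → x ν' = d • y → ν = ν')
    {V : κ → Submodule ℂ (Fin n → ℂ)} (hV : iSupIndep V)
    {z : Fin n → ℂ} (hz : z ≠ 0) {v : κ → Fin n → ℂ} (hv : ∀ ν, v ν ∈ V ν)
    (h : ∀ i k, y i * z k = ∑ ν, x ν i * v ν k) :
    ∃ ν, ∃ c : ℂ, c ≠ 0 ∧ x ν = c • y ∧ z ∈ V ν := by
  obtain ⟨i₀, hi₀⟩ : ∃ i, y i ≠ 0 := by
    by_contra! h0
    exact hy (by ext i; exact h0 i)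
  have hz' : z = (y i₀)⁻¹ • ∑ ν, x ν i₀ • v ν := by
    ext k
    simp [Finset.sum_apply, ← h i₀ k, hi₀]
  -- Eliminating `z` between the rows `i` and `i₀` gives a vanishing sum of vectors from the `V ν`.
  have hcoef : ∀ ν i, v ν ≠ 0 → x ν i * y i₀ = y i * x ν i₀ := by
    intro ν i hν
    have := hV.eq_zero_of_sum_eq_zero (v := fun ν => (x ν i * y i₀ - y i * x ν i₀) • v ν)
      (fun ν => (V ν).smul_mem _ (hv ν)) (by
        ext k
        simp only [Finset.sum_apply, Pi.smul_apply, smul_eq_mul, Pi.zero_apply]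
        have e : ∀ ν, (x ν i * y i₀ - y i * x ν i₀) * v ν k =
            y i₀ * (x ν i * v ν k) - y i * (x ν i₀ * v ν k) := fun ν => by ring
        simp only [e, Finset.sum_sub_distrib, ← Finset.mul_sum, ← h]
        ring) ν
    rcases smul_eq_zero.1 this with h0 | h0
    · exact sub_eq_zero.1 h0
    · exact absurd h0 hν
  have hpar : ∀ ν, v ν ≠ 0 → x ν = (x ν i₀ / y i₀) • y := by
    intro ν hν
    ext i
    have := hcoef ν i hν
    simp only [PiLp.smul_apply, smul_eq_mul]
    field_simp
    linear_combination this
  obtain ⟨ν, hν⟩ : ∃ ν, v ν ≠ 0 := by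
    by_contra! h0
    exact hz (by rw [hz']; simp [h0])
  refine ⟨ν, _, fun h0 => hx ν ?_, hpar ν hν, ?_⟩
  · rw [hpar ν hν, h0, zero_smul]
  · rw [hz', Finset.sum_eq_single ν]
    · exact (V ν).smul_mem _ ((V ν).smul_mem _ (hv ν))
    · intro ν' _ hne
      by_contra h0
      exact hne (hxy _ _ _ _ (hpar ν' fun h' => h0 (by rw [h', smul_zero])) (hpar ν hν))
    · simp

/-- Each diagonal block gives a vanishing sum of `P_{x_ν}(i,i) E_ν`; directness kills every term,
and summing over `i` removes the factor because the trace is one. -/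
theorem eq_zero_of_sum_pureState_kronecker_eq_zero {x : κ → EuclideanSpace ℂ (Fin m)}
    (hx : ∀ ν, ‖x ν‖ = 1) {V : κ → Submodule ℂ (Fin n → ℂ)} (hV : iSupIndep V)
    {E : κ → Matrix (Fin n) (Fin n) ℂ} (hE : ∀ ν, LinearMap.range (E ν).mulVecLin ≤ V ν)
    (h : ∑ ν, pureState (x ν) ⊗ₖ E ν = 0) (ν : κ) : E ν = 0 := by
  have key : ∀ i (u : Fin n → ℂ), pureState (x ν) i i • (E ν *ᵥ u) = 0 := by
    intro i u
    refine hV.eq_zero_of_sum_eq_zero (v := fun ν => pureState (x ν) i i • (E ν *ᵥ u))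
      (fun ν => (V ν).smul_mem _ (hE ν ⟨u, rfl⟩)) ?_ ν
    have h0 : ∑ ν, pureState (x ν) i i • E ν = 0 := by
      ext k l
      have := congrFun (congrFun h (i, k)) (i, l)
      simpa [Matrix.sum_apply] using this
    simp only [← smul_mulVec, ← sum_mulVec, h0, zero_mulVec]
  apply Matrix.ext_iff_mulVec.2
  intro u
  have := Finset.sum_eq_zero fun i (_ : i ∈ Finset.univ) => key i u
  rw [← Finset.sum_smul, show ∑ i, pureState (x ν) i i = 1 from trace_pureState (hx ν),
    one_smul] at this
  rw [this, zero_mulVec]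

theorem eq_of_sum_pureState_kronecker_eq {x : κ → EuclideanSpace ℂ (Fin m)}
    (hx : ∀ ν, ‖x ν‖ = 1) {V : κ → Submodule ℂ (Fin n → ℂ)} (hV : iSupIndep V)
    {E F : κ → Matrix (Fin n) (Fin n) ℂ} (hE : ∀ ν, LinearMap.range (E ν).mulVecLin ≤ V ν)
    (hF : ∀ ν, LinearMap.range (F ν).mulVecLin ≤ V ν)
    (h : ∑ ν, pureState (x ν) ⊗ₖ E ν = ∑ ν, pureState (x ν) ⊗ₖ F ν) : E = F := by
  funext ν
  refine sub_eq_zero.1 (eq_zero_of_sum_pureState_kronecker_eq_zero hx hV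
    (E := fun ν => E ν - F ν) (fun ν => ?_) ?_ ν)
  · rintro _ ⟨u, rfl⟩
    rw [mulVecLin_apply, sub_mulVec]
    exact (V ν).sub_mem (hE ν ⟨u, rfl⟩) (hF ν ⟨u, rfl⟩)
  · rw [← sub_eq_zero.2 h, ← Finset.sum_sub_distrib]
    refine Finset.sum_congr rfl fun ν _ => ?_
    ext ⟨i, k⟩ ⟨j, l⟩
    simp [mul_sub]

end Independent

/-! ### Canonical decompositions and the face of `T`. -/

namespace IsCanonicalDecomposition

variable {m n q : ℕ} {T : Matrix (Fin m × Fin n) (Fin m × Fin n) ℂ} {w : Fin q → ℝ}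
  {x : Fin q → EuclideanSpace ℂ (Fin m)} {C : Fin q → Matrix (Fin n) (Fin n) ℂ}

theorem exists_of_mem_range (h : IsCanonicalDecomposition T w x C) {a : Fin m → ℂ}
    {b : Fin n → ℂ} (ha : a ≠ 0) (hb : b ≠ 0)
    (hab : (fun p : Fin m × Fin n => a p.1 * b p.2) ∈ LinearMap.range T.mulVecLin) :
    ∃ ν, b ∈ LinearMap.range (C ν).mulVecLin ∧
      ∃ r : ℝ, 0 < r ∧ vecMulVec a (star a) = r • pureState (x ν) := by
  have hscale : ∀ ν (c : ℂ), x ν = c • WithLp.toLp 2 a →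
      c ≠ 0 ∧ pureState (WithLp.toLp 2 a) = ((‖c‖ ^ 2)⁻¹ : ℝ) • pureState (x ν) := by
    intro ν c hc
    have hc0 : c ≠ 0 := by
      rintro rfl
      have := h.norm_eq_one ν
      rw [hc, zero_smul, norm_zero] at this
      exact zero_ne_one this
    refine ⟨hc0, ?_⟩
    rw [hc, pureState_smul, inv_smul_smul₀]
    simpa using hc0
  obtain ⟨f, hf⟩ := hab
  obtain ⟨ν, c, -, hc, hbν⟩ := exists_eq_smul_of_mul_eq_sum (x := x) (y := WithLp.toLp 2 a)
    (fun ν h0 => by simpa [h0] using h.norm_eq_one ν) (by simpa using ha)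
    -- Two `x ν` parallel to `a` have proportional projections, and equal traces make these equal.
    (by
      intro ν ν' c d hc hd
      refine h.distinct ?_
      have e := (hscale ν c hc).2.symm.trans (hscale ν' d hd).2
      have e' := congrArg trace e
      rw [trace_smul, trace_smul, trace_pureState (h.norm_eq_one ν),
        trace_pureState (h.norm_eq_one ν')] at e'
      have e'' : (‖c‖ ^ 2)⁻¹ = (‖d‖ ^ 2)⁻¹ := Complex.ofReal_injective (by simpa using e')
      rw [e''] at e
      refine smul_right_injective _ ?_ e
      simpa using (hscale ν' d hd).1)
    h.independent hb
    (v := fun ν => C ν *ᵥ (w ν • fun l => ∑ j, star (x ν j) * f (j, l)))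
    (fun ν => ⟨_, rfl⟩) (by
      intro i k
      rw [mulVecLin_apply, h.eq_sum, sum_mulVec] at hf
      have := congrFun hf (i, k)
      simp only [smul_mulVec, pureState_kronecker_mulVec, Finset.sum_apply] at this
      rw [← this]
      refine Finset.sum_congr rfl fun ν _ => ?_
      rw [mulVec_smul]
      simp only [Pi.smul_apply, Complex.real_smul]
      ring)
  obtain ⟨hc0, e⟩ := hscale ν c hc
  exact ⟨ν, hbν, _, by positivity, e⟩

theorem exists_of_posSemidef_sub (h : IsCanonicalDecomposition T w x C)
    {r : ℝ} {a : Fin m → ℂ} {b : Fin n → ℂ} (ha : a ≠ 0) (hb : b ≠ 0)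
    (hab : (r • T - vecMulVec a (star a) ⊗ₖ vecMulVec b (star b)).PosSemidef) :
    ∃ ν, b ∈ LinearMap.range (C ν).mulVecLin ∧
      ∃ r : ℝ, 0 < r ∧ vecMulVec a (star a) = r • pureState (x ν) := by
  rw [vecMulVec_kronecker_vecMulVec] at hab
  exact h.exists_of_mem_range ha hb
    (range_smul_mulVecLin_le r T (mem_range_mulVecLin_of_posSemidef_sub hab))

/-- The sums `∑ P_{x_ν} ⊗ E_ν` with positive semidefinite `E_ν` whose images lie in those of the
`C_ν`. -/
def supportedCone (x : Fin q → EuclideanSpace ℂ (Fin m)) (C : Fin q → Matrix (Fin n) (Fin n) ℂ) :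
    Set (Matrix (Fin m × Fin n) (Fin m × Fin n) ℂ) :=
  {X | ∃ E : Fin q → Matrix (Fin n) (Fin n) ℂ, (∀ ν, (E ν).PosSemidef) ∧
    (∀ ν, LinearMap.range (E ν).mulVecLin ≤ LinearMap.range (C ν).mulVecLin) ∧
    X = ∑ ν, pureState (x ν) ⊗ₖ E ν}

theorem zero_mem_supportedCone : 0 ∈ supportedCone x C :=
  ⟨0, fun _ => .zero, fun ν => by rintro _ ⟨u, rfl⟩; simp, by simp⟩

theorem sum_mem_supportedCone {α : Type*} {s : Finset α}
    {X : α → Matrix (Fin m × Fin n) (Fin m × Fin n) ℂ}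
    (hX : ∀ a ∈ s, X a ∈ supportedCone x C) : ∑ a ∈ s, X a ∈ supportedCone x C := by
  choose! E hE hr hs using hX
  refine ⟨fun ν => ∑ a ∈ s, E a ν, fun ν => posSemidef_sum _ fun a ha => hE a ha ν,
    fun ν => ?_, ?_⟩
  · rintro _ ⟨u, rfl⟩
    rw [mulVecLin_apply, sum_mulVec]
    exact Submodule.sum_mem _ fun a ha => hr a ha ν ⟨u, rfl⟩
  · rw [Finset.sum_congr rfl hs, Finset.sum_comm]
    simp only [kronecker_sum]

/-- Each rank one product term in a splitting of `X` is itself dominated by `r T`, so it belongs to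
a single index `ν`. -/
theorem mem_supportedCone (h : IsCanonicalDecomposition T w x C)
    {X : Matrix (Fin m × Fin n) (Fin m × Fin n) ℂ} (hX : X ∈ separableCone m n) {r : ℝ}
    (hr : (r • T - X).PosSemidef) : X ∈ supportedCone x C := by
  obtain ⟨p, A, B, hA, hB, rfl⟩ := hX
  refine sum_mem_supportedCone fun γ hγ => ?_
  replace hr := posSemidef_sub_of_posSemidef_sub_sum (fun γ _ => (hA γ).kronecker (hB γ)) hr hγ
  obtain ⟨a, ha⟩ := (hA γ).exists_sum_vecMulVec
  obtain ⟨b, hb⟩ := (hB γ).exists_sum_vecMulVec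
  rw [ha, sum_kronecker] at hr ⊢
  refine sum_mem_supportedCone fun i hi => ?_
  replace hr := posSemidef_sub_of_posSemidef_sub_sum
    (X := fun i => vecMulVec (a i) (star (a i)) ⊗ₖ B γ)
    (fun i _ => (posSemidef_vecMulVec_self_star _).kronecker (hB γ)) hr hi
  simp only [hb, kronecker_sum] at hr ⊢
  refine sum_mem_supportedCone fun k hk => ?_
  replace hr := posSemidef_sub_of_posSemidef_sub_sum
    (X := fun k => vecMulVec (a i) (star (a i)) ⊗ₖ vecMulVec (b k) (star (b k)))
    (fun k _ => (posSemidef_vecMulVec_self_star _).kronecker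
      (posSemidef_vecMulVec_self_star _)) hr hk
  by_cases ha0 : a i = 0
  · simpa [ha0] using zero_mem_supportedCone
  by_cases hb0 : b k = 0
  · simpa [hb0] using zero_mem_supportedCone
  obtain ⟨ν, hbν, t, ht, e⟩ := h.exists_of_posSemidef_sub ha0 hb0 hr
  refine ⟨Pi.single ν (t • vecMulVec (b k) (star (b k))), fun μ => ?_, fun μ => ?_, ?_⟩
  · rcases eq_or_ne μ ν with rfl | hμ
    · rw [Pi.single_eq_same]
      exact (posSemidef_vecMulVec_self_star _).smul ht.le
    · rw [Pi.single_eq_of_ne hμ]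
      exact .zero
  · rcases eq_or_ne μ ν with rfl | hμ
    · rw [Pi.single_eq_same]
      refine (range_smul_mulVecLin_le _ _).trans ?_
      rintro _ ⟨u, rfl⟩
      rw [mulVecLin_apply, vecMulVec_mulVec, op_smul_eq_smul]
      exact Submodule.smul_mem _ _ hbν
    · rw [Pi.single_eq_of_ne hμ]
      rintro _ ⟨u, rfl⟩
      simp
  · rw [Finset.sum_eq_single ν (fun μ _ hμ => by simp [Pi.single_eq_of_ne hμ]) (by simp),
      Pi.single_eq_same, e, smul_kronecker, kronecker_smul]

theorem pureState_kronecker_mem (h : IsCanonicalDecomposition T w x C) (ν : Fin q) :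
    pureState (x ν) ⊗ₖ C ν ∈ separableStates m n :=
  kronecker_mem_separableStates (pureState_mem_stateSpace (h.norm_eq_one ν)) (h.density ν)

theorem mem_separableStates (h : IsCanonicalDecomposition T w x C) : T ∈ separableStates m n := by
  rw [h.eq_sum]
  exact convex_separableStates.sum_mem (fun ν _ => (h.weight_pos ν).le) h.weight_sum
    fun ν _ => h.pureState_kronecker_mem ν

theorem generatedFace_subset (h : IsCanonicalDecomposition T w x C) (ν : Fin q) :
    generatedFace (separableStates m n) (pureState (x ν) ⊗ₖ C ν) ⊆
      generatedFace (separableStates m n) T := by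
  have hF := isConvexFace_generatedFace convex_separableStates h.mem_separableStates
  refine _root_.generatedFace_subset hF (hF.mem_of_sum_mem (w := w)
    (z := fun ν => pureState (x ν) ⊗ₖ C ν) convex_separableStates
    (fun ν => (h.weight_pos ν).le) h.weight_sum h.pureState_kronecker_mem ?_ (h.weight_pos ν))
  rw [← h.eq_sum]
  exact self_mem_generatedFace _ _

theorem exists_of_mem_generatedFace (h : IsCanonicalDecomposition T w x C)
    {A : Matrix (Fin m × Fin n) (Fin m × Fin n) ℂ}
    (hA : A ∈ generatedFace (separableStates m n) T) :
    ∃ t ∈ stdSimplex ℝ (Fin q), ∃ D : Fin q → Matrix (Fin n) (Fin n) ℂ,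
      (∀ ν, D ν ∈ generatedFace (stateSpace (Fin n)) (C ν)) ∧
      A = ∑ ν, t ν • (pureState (x ν) ⊗ₖ D ν) := by
  obtain ⟨hAS, r, hr⟩ := (mem_generatedFace_separableStates h.mem_separableStates).1 hA
  obtain ⟨E, hE, hEC, hAE⟩ := h.mem_supportedCone hAS.2 (posSemidef_of_mem_separableCone hr)
  obtain ⟨F, hF, hFC, hRF⟩ := h.mem_supportedCone (r := r) hr
    (by rw [sub_sub_cancel]; exact hAS.1.1)
  -- Coefficients of `r T = A + (r T - A)` are compared; all images lie in those of the `C ν`.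
  have hEF : (fun ν => (r * w ν) • C ν) = fun ν => E ν + F ν := by
    refine eq_of_sum_pureState_kronecker_eq h.norm_eq_one h.independent
      (fun ν => range_smul_mulVecLin_le _ _) (fun ν => ?_) ?_
    · rintro _ ⟨u, rfl⟩
      rw [mulVecLin_apply, add_mulVec]
      exact Submodule.add_mem _ (hEC ν ⟨u, rfl⟩) (hFC ν ⟨u, rfl⟩)
    · simp only [kronecker_add, Finset.sum_add_distrib, ← hAE, ← hRF, add_sub_cancel]
      rw [h.eq_sum, Finset.smul_sum]
      exact Finset.sum_congr rfl fun ν _ => by rw [kronecker_smul, smul_smul]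
  have hD : ∀ ν, ∃ t : ℝ, 0 ≤ t ∧ ∃ D ∈ generatedFace (stateSpace (Fin n)) (C ν),
      E ν = t • D := by
    intro ν
    by_cases h0 : E ν = 0
    -- With weight zero any point of the face will do.
    · exact ⟨0, le_rfl, C ν, self_mem_generatedFace _ _, by rw [h0, zero_smul]⟩
    · obtain ⟨t, ht, D, hD, e⟩ := (hE ν).exists_smul_stateSpace h0
      -- This multiple of `C ν` exceeds `D` by exactly `t⁻¹ F ν`.
      refine ⟨t, ht.le, D, (mem_generatedFace_stateSpace (h.density ν)).2
        ⟨hD, t⁻¹ * (r * w ν), ?_⟩, e⟩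
      rw [mul_smul, congrFun hEF ν, e, smul_add, inv_smul_smul₀ ht.ne', add_sub_cancel_left]
      exact (hF ν).smul (by positivity)
  choose t ht D hD hED using hD
  have hAD : A = ∑ ν, t ν • (pureState (x ν) ⊗ₖ D ν) := by
    rw [hAE]
    exact Finset.sum_congr rfl fun ν _ => by rw [hED, kronecker_smul]
  refine ⟨t, ⟨ht, ?_⟩, D, hD, hAD⟩
  have htr := hAS.1.2
  rw [hAD, trace_sum] at htr
  have : ∀ ν, (t ν • (pureState (x ν) ⊗ₖ D ν)).trace = (t ν : ℂ) := fun ν => by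
    rw [trace_smul, trace_kronecker, trace_pureState (h.norm_eq_one ν),
      ((mem_generatedFace_stateSpace (h.density ν)).1 (hD ν)).1.2]
    simp
  simp only [this] at htr
  exact_mod_cast htr

/-- Uniqueness: the products `t_ν D_ν` are determined as coefficients, and their traces recover
`t_ν`. -/
theorem isDirectConvexSum (h : IsCanonicalDecomposition T w x C) :
    IsDirectConvexSum
      (fun ν => (fun D => pureState (x ν) ⊗ₖ D) '' generatedFace (stateSpace (Fin n)) (C ν))
      (generatedFace (separableStates m n) T) := by
  have hex : ∀ y ∈ generatedFace (separableStates m n) T, ∃ t ∈ stdSimplex ℝ (Fin q),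
      ∃ z : Fin q → Matrix (Fin m × Fin n) (Fin m × Fin n) ℂ,
        (∀ ν, z ν ∈ (fun D => pureState (x ν) ⊗ₖ D) ''
          generatedFace (stateSpace (Fin n)) (C ν)) ∧ y = ∑ ν, t ν • z ν := by
    intro y hy
    obtain ⟨t, ht, D, hD, e⟩ := h.exists_of_mem_generatedFace hy
    exact ⟨t, ht, _, fun ν => ⟨D ν, hD ν, rfl⟩, e⟩
  refine ⟨Set.Subset.antisymm ?_ (convexHull_min (Set.iUnion_subset fun ν => ?_)
    (isConvexFace_generatedFace convex_separableStates h.mem_separableStates).1), ?_⟩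
  · intro y hy
    obtain ⟨t, ht, z, hz, rfl⟩ := hex y hy
    exact (convex_convexHull ℝ _).sum_mem (fun ν _ => ht.1 ν) ht.2
      fun ν _ => subset_convexHull ℝ _ (Set.mem_iUnion.2 ⟨ν, hz ν⟩)
  · rw [← generatedFace_pureState_kronecker (h.norm_eq_one ν) (h.density ν),
      ← generatedFace_separableStates_pureState_kronecker (h.norm_eq_one ν) (h.density ν)]
    exact h.generatedFace_subset ν
  · refine fun y hy => ⟨hex y hy, fun t _ t' _ z z' hz hz' e e' ν => ?_⟩
    choose D hD hDz using hz
    choose D' hD' hDz' using hz'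
    obtain rfl : (fun ν => pureState (x ν) ⊗ₖ D ν) = z := funext hDz
    obtain rfl : (fun ν => pureState (x ν) ⊗ₖ D' ν) = z' := funext hDz'
    have hle : ∀ (t : Fin q → ℝ) {D : Fin q → Matrix (Fin n) (Fin n) ℂ},
        (∀ ν, D ν ∈ generatedFace (stateSpace (Fin n)) (C ν)) → ∀ ν,
        LinearMap.range (t ν • D ν).mulVecLin ≤ LinearMap.range (C ν).mulVecLin :=
      fun t D hD ν => (range_smul_mulVecLin_le _ _).trans
        (range_le_of_mem_generatedFace (h.density ν) (hD ν))
    have htr : ∀ {D : Fin q → Matrix (Fin n) (Fin n) ℂ},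
        (∀ ν, D ν ∈ generatedFace (stateSpace (Fin n)) (C ν)) → ∀ ν, (D ν).trace = 1 :=
      fun hD ν => ((mem_generatedFace_stateSpace (h.density ν)).1 (hD ν)).1.2
    have key := congrFun (eq_of_sum_pureState_kronecker_eq h.norm_eq_one h.independent
      (hle t hD) (hle t' hD') (by simpa only [kronecker_smul] using e.symm.trans e')) ν
    have ht : t ν = t' ν := by
      have := congrArg trace key
      rw [trace_smul, trace_smul, htr hD, htr hD'] at this
      exact Complex.ofReal_injective (by simpa using this)
    refine ⟨ht, fun h0 => ?_⟩
    rw [← ht] at key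
    dsimp only
    rw [smul_right_injective _ h0 key]

/-! ### Uniqueness of the decomposition. -/

section Uniqueness

variable {q' : ℕ} {w' : Fin q' → ℝ} {x' : Fin q' → EuclideanSpace ℂ (Fin m)}
  {C' : Fin q' → Matrix (Fin n) (Fin n) ℂ}

/-- Every `x'_μ ⊗ b` with `b` in the image of `C'_μ` lies in the range of `T`. The index found for
`b` has projection `P_{x'_μ}`, so by distinctness it does not depend on `b`. -/
theorem exists_pureState_eq (h : IsCanonicalDecomposition T w x C)
    (h' : IsCanonicalDecomposition T w' x' C') (μ : Fin q') :
    ∃ ν, pureState (x' μ) = pureState (x ν) ∧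
      LinearMap.range (C' μ).mulVecLin ≤ LinearMap.range (C ν).mulVecLin := by
  obtain ⟨u, hu⟩ := (h'.density μ).1.exists_sum_vecMulVec
  have hx' : (x' μ).ofLp ≠ 0 := fun h0 => by
    have := h'.norm_eq_one μ
    rw [show x' μ = 0 by ext i; exact congrFun h0 i, norm_zero] at this
    exact zero_ne_one this
  have hwC : LinearMap.range (pureState (x' μ) ⊗ₖ C' μ).mulVecLin ≤
      LinearMap.range T.mulVecLin := by
    have h1 : ((w' μ)⁻¹ • T - pureState (x' μ) ⊗ₖ C' μ).PosSemidef := by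
      have h2 := posSemidef_sub_of_posSemidef_sub_sum (s := Finset.univ) (T := T)
        (X := fun ν => w' ν • (pureState (x' ν) ⊗ₖ C' ν))
        (fun ν _ => (h'.pureState_kronecker_mem ν).1.1.smul (h'.weight_pos ν).le)
        (by rw [← h'.eq_sum, sub_self]; exact .zero) (Finset.mem_univ μ)
      have h3 := h2.smul (inv_nonneg.2 (h'.weight_pos μ).le)
      rwa [smul_sub, inv_smul_smul₀ (h'.weight_pos μ).ne'] at h3
    exact ((h'.pureState_kronecker_mem μ).1.1.range_le_of_posSemidef_sub h1).trans
      (range_smul_mulVecLin_le _ _)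
  have key : ∀ b ∈ LinearMap.range (C' μ).mulVecLin, b ≠ 0 →
      ∃ ν, b ∈ LinearMap.range (C ν).mulVecLin ∧ pureState (x' μ) = pureState (x ν) := by
    rintro _ ⟨v, rfl⟩ hb
    obtain ⟨ν, hbν, r, -, e⟩ := h.exists_of_mem_range hx' hb (hwC ⟨fun p => x' μ p.1 * v p.2, by
      rw [mulVecLin_apply, pureState_kronecker_mulVec]
      have h1 : ∑ j, star (x' μ j) * x' μ j = 1 := by
        rw [← trace_pureState (h'.norm_eq_one μ)]
        exact Finset.sum_congr rfl fun j _ => mul_comm _ _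
      have h2 : (fun l => ∑ j, star (x' μ j) * (x' μ j * v l)) = v := by
        funext l
        simp only [← mul_assoc, ← Finset.sum_mul, h1, one_mul]
      simp only [h2]
      rfl⟩)
    refine ⟨ν, hbν, ?_⟩
    change pureState (x' μ) = _ at e
    have e' := congrArg trace e
    rw [trace_smul, trace_pureState (h.norm_eq_one ν), trace_pureState (h'.norm_eq_one μ)] at e'
    rw [e, show r = 1 from Complex.ofReal_injective (by simpa using e'.symm), one_smul]
  obtain ⟨v, hv⟩ : ∃ v, C' μ *ᵥ v ≠ 0 := by
    by_contra! h0
    have h1 : C' μ = 0 := Matrix.ext_iff_mulVec.2 fun v => by rw [h0, zero_mulVec]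
    have := (h'.density μ).2
    rw [h1, trace_zero] at this
    exact zero_ne_one this
  obtain ⟨ν, -, hν⟩ := key _ ⟨v, rfl⟩ hv
  refine ⟨ν, hν, fun b hb => ?_⟩
  by_cases hb0 : b = 0
  · rw [hb0]; exact Submodule.zero_mem _
  obtain ⟨ν', hbν', hν'⟩ := key b hb hb0
  rwa [h.distinct (hν.symm.trans hν')]

theorem exists_equiv (h : IsCanonicalDecomposition T w x C)
    (h' : IsCanonicalDecomposition T w' x' C') :
    ∃ σ : Fin q ≃ Fin q', ∀ ν, w' (σ ν) = w ν ∧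
      pureState (x' (σ ν)) = pureState (x ν) ∧ C' (σ ν) = C ν := by
  choose f hf hfC using h.exists_pureState_eq h'
  choose g hg hgC using h'.exists_pureState_eq h
  -- Both maps preserve projections, so distinctness makes them mutually inverse.
  let σ : Fin q ≃ Fin q' :=
    ⟨g, f, fun ν => h.distinct ((hf _).symm.trans (hg ν).symm),
      fun μ => h'.distinct ((hg _).symm.trans (hf μ).symm)⟩
  refine ⟨σ, fun ν => ?_⟩
  have key := congrFun (eq_of_sum_pureState_kronecker_eq h.norm_eq_one h.independent
    (E := fun ν => w ν • C ν) (F := fun ν => w' (σ ν) • C' (σ ν))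
    (fun ν => range_smul_mulVecLin_le _ _)
    (fun ν => (range_smul_mulVecLin_le _ _).trans
      ((hfC (σ ν)).trans_eq (by rw [show f (σ ν) = ν from σ.left_inv ν]))) (by
      simp only [kronecker_smul, ← h.eq_sum]
      refine h'.eq_sum.trans ((σ.sum_comp _).symm.trans (Finset.sum_congr rfl fun ν _ => ?_))
      rw [show pureState (x' (σ ν)) = pureState (x ν) from (hg ν).symm])) ν
  have hw : w' (σ ν) = w ν := by
    have := congrArg trace key
    simp only [trace_smul, (h.density ν).2, (h'.density (σ ν)).2] at this
    exact (Complex.ofReal_injective (by simpa using this)).symm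
  refine ⟨hw, (hg ν).symm, ?_⟩
  simp only [hw] at key
  exact (smul_right_injective _ (h.weight_pos ν).ne' key).symm

end Uniqueness

/-! ### Existence: merging terms with equal projections. -/

theorem exists_of_sum {κ : Type*} [Fintype κ] (hT : T ∈ stateSpace (Fin m × Fin n))
    {y : κ → EuclideanSpace ℂ (Fin m)} {B : κ → Matrix (Fin n) (Fin n) ℂ}
    (hy : ∀ γ, ‖y γ‖ = 1) (hB : ∀ γ, (B γ).PosSemidef) (hB0 : ∀ γ, B γ ≠ 0)
    (hBi : IndependentImages B) (hTB : T = ∑ γ, pureState (y γ) ⊗ₖ B γ) :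
    ∃ (q : ℕ) (w : Fin q → ℝ) (x : Fin q → EuclideanSpace ℂ (Fin m))
      (C : Fin q → Matrix (Fin n) (Fin n) ℂ), IsCanonicalDecomposition T w x C := by
  classical
  -- The new index set enumerates the distinct projections, and `g` sends a term to its projection.
  let s : Finset (Matrix (Fin m) (Fin m) ℂ) := Finset.univ.image fun γ => pureState (y γ)
  let g : κ → Fin s.card := fun γ =>
    s.equivFin ⟨pureState (y γ), Finset.mem_image_of_mem _ (Finset.mem_univ γ)⟩
  have hg : ∀ γ, (s.equivFin.symm (g γ) : Matrix (Fin m) (Fin m) ℂ) = pureState (y γ) :=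
    fun γ => by simp [g]
  have hfib : ∀ ν, ∃ γ, g γ = ν := by
    intro ν
    obtain ⟨γ, -, hγ⟩ := Finset.mem_image.1 (s.equivFin.symm ν).2
    exact ⟨γ, by rw [← Equiv.apply_symm_apply s.equivFin ν]; exact congrArg _ (Subtype.ext hγ)⟩
  have hG : ∀ ν, ∃ r : ℝ, 0 < r ∧ ∃ D ∈ stateSpace (Fin n), ∑ γ with g γ = ν, B γ = r • D := by
    intro ν
    refine (posSemidef_sum _ fun γ _ => hB γ).exists_smul_stateSpace fun h0 => ?_
    obtain ⟨γ, hγ⟩ := hfib ν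
    have := congrArg trace h0
    -- A vanishing sum of nonnegative traces would make a term `B γ` zero.
    rw [trace_sum, trace_zero, Finset.sum_eq_zero_iff_of_nonneg fun γ _ => (hB γ).trace_nonneg]
      at this
    exact hB0 γ ((hB γ).trace_eq_zero_iff.1 (this γ (by simp [hγ])))
  choose γ hγ using hfib
  choose w hw C hC hGC using hG
  have hTsum : T = ∑ ν, w ν • (pureState (y (γ ν)) ⊗ₖ C ν) := by
    rw [hTB, ← Finset.sum_fiberwise _ g]
    refine Finset.sum_congr rfl fun ν _ => ?_
    rw [← kronecker_smul, ← hGC, kronecker_sum]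
    refine Finset.sum_congr rfl fun γ' hγ' => ?_
    rw [← hg, ← hg, hγ, (Finset.mem_filter.1 hγ').2]
  refine ⟨s.card, w, fun ν => y (γ ν), C, hw, ?_, fun ν => hy _, fun ν ν' h => ?_, hC, ?_, hTsum⟩
  · have htr := hT.2
    rw [hTsum, trace_sum] at htr
    simp only [trace_smul, trace_kronecker, trace_pureState (hy _), (hC _).2, mul_one,
      Complex.real_smul] at htr
    exact_mod_cast htr
  · dsimp only at h
    rw [← hg, ← hg, hγ, hγ] at h
    exact s.equivFin.symm.injective (Subtype.ext h)
  · refine iSupIndep.mono (hBi.sum_fiber g) fun ν => ?_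
    dsimp only
    rw [hGC]
    conv_lhs => rw [← inv_smul_smul₀ (hw ν).ne' (C ν)]
    exact range_smul_mulVecLin_le _ _

end IsCanonicalDecomposition

theorem mainTheorem5 (m n p : ℕ)
    (T : Matrix (Fin m × Fin n) (Fin m × Fin n) ℂ)
    (hT : T ∈ stateSpace (Fin m × Fin n))
    (A : Fin p → Matrix (Fin m) (Fin m) ℂ) (B : Fin p → Matrix (Fin n) (Fin n) ℂ)
    (hA : ∀ γ, A γ ∈ stateSpace (Fin m)) (hA_rank : ∀ γ, (A γ).rank = 1)
    (hB : ∀ γ, (B γ).PosSemidef) (hB_ind : IndependentImages B)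
    (hTAB : T = ∑ γ, A γ ⊗ₖ B γ) :
    ∃ (q : ℕ) (w : Fin q → ℝ) (x : Fin q → EuclideanSpace ℂ (Fin m))
      (C : Fin q → Matrix (Fin n) (Fin n) ℂ),
      IsCanonicalDecomposition T w x C ∧
      (∀ (q' : ℕ) (w' : Fin q' → ℝ) (x' : Fin q' → EuclideanSpace ℂ (Fin m))
        (C' : Fin q' → Matrix (Fin n) (Fin n) ℂ), IsCanonicalDecomposition T w' x' C' →
        ∃ σ : Fin q ≃ Fin q', ∀ ν, w' (σ ν) = w ν ∧
          pureState (x' (σ ν)) = pureState (x ν) ∧ C' (σ ν) = C ν) ∧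
      (∀ ν,
        IsConvexFace (stateSpace (Fin m × Fin n))
          (generatedFace (separableStates m n) (pureState (x ν) ⊗ₖ C ν)) ∧
        generatedFace (separableStates m n) (pureState (x ν) ⊗ₖ C ν) =
          generatedFace (stateSpace (Fin m × Fin n)) (pureState (x ν) ⊗ₖ C ν) ∧
        generatedFace (stateSpace (Fin m × Fin n)) (pureState (x ν) ⊗ₖ C ν) =
          (fun D => pureState (x ν) ⊗ₖ D) '' generatedFace (stateSpace (Fin n)) (C ν)) ∧
      IsDirectConvexSum
        (fun ν => generatedFace (stateSpace (Fin m × Fin n)) (pureState (x ν) ⊗ₖ C ν))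
        (generatedFace (separableStates m n) T) ∧
      IsDirectConvexSum
        (fun ν => (fun D => pureState (x ν) ⊗ₖ D) '' generatedFace (stateSpace (Fin n)) (C ν))
        (generatedFace (separableStates m n) T) := by
  choose y hy hAy using fun γ => exists_pureState_of_rank_eq_one (hA γ) (hA_rank γ)
  -- Zero matrices `B γ` are discarded first, since they cannot be normalised to density matrices.
  obtain ⟨q, w, x, C, h⟩ := IsCanonicalDecomposition.exists_of_sum (κ := {γ // B γ ≠ 0}) hT
    (y := fun γ => y γ) (B := fun γ => B γ) (fun γ => hy γ) (fun γ => hB γ) (fun γ => γ.2)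
    (iSupIndep.comp hB_ind Subtype.val_injective) (by
      classical
      rw [hTAB, ← Finset.sum_subtype (Finset.univ.filter fun γ => B γ ≠ 0) (by simp)
        fun γ => pureState (y γ) ⊗ₖ B γ]
      simp only [← hAy]
      refine (Finset.sum_filter_of_ne (p := fun γ => B γ ≠ 0) fun γ _ hne hB0 => hne ?_).symm
      rw [hB0, kronecker_zero])
  have hface : ∀ ν, generatedFace (stateSpace (Fin m × Fin n)) (pureState (x ν) ⊗ₖ C ν) =
      (fun D => pureState (x ν) ⊗ₖ D) '' generatedFace (stateSpace (Fin n)) (C ν) :=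
    fun ν => generatedFace_pureState_kronecker (h.norm_eq_one ν) (h.density ν)
  have hfaceS : ∀ ν, generatedFace (separableStates m n) (pureState (x ν) ⊗ₖ C ν) =
      generatedFace (stateSpace (Fin m × Fin n)) (pureState (x ν) ⊗ₖ C ν) :=
    fun ν => generatedFace_separableStates_pureState_kronecker (h.norm_eq_one ν) (h.density ν)
  refine ⟨q, w, x, C, h, fun _ _ _ _ h' => h.exists_equiv h', fun ν => ⟨?_, hfaceS ν, hface ν⟩,
    ?_, h.isDirectConvexSum⟩
  · rw [hfaceS]
    exact isConvexFace_generatedFace convex_stateSpace (h.pureState_kronecker_mem ν).1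
  · simp only [hface]
    exact h.isDirectConvexSum
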